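/- Let $V$ be a finite nonempty set and let $P$ be a stochastic matrix indexed by $V$ (that is, $P(u,v)\ge 0$ and $\sum_{v}P(u,v)=1$ for all $u$) which is mixing, meaning that for some $n\ge 1$ all entries of $P^n$ are positive. Let $\pi$ be the stationary distribution of $P$, i.e. the unique probability vector with $\pi P=\pi$, and let $$h(V,P)=-\sum_{u,v\in V}\pi(u)P(u,v)\log P(u,v)\qquad(0\log 0=0)$$ be the entropy of the chain. Let $Q$ be the matrix with entries $Q(u,v)=P(u,v)^2$, let $\lambda$ be its Perron eigenvalue (its spectral radius), and put $L(V,P)=-\log\lambda$. Call $(V,P)$ a measure of maximal entropy if $h(V,P)\ge h(V,P')$ for every stochastic matrix $P'$ indexed by $V$ such that $P(u,v)>0$ whenever $P'(u,v)>0$; here $h(V,P')$ is given by the same formula, and if $P'$ has several stationary distributions $\pi'$, the inequality is required for each of them. Then: 1. $0\le L(V,P)\le h(V,P)$; 2. $L(V,P)=0$ if and only if $|V|=1$; 3. $L(V,P)=h(V,P)$ if and only if $(V,P)$ is a measure of maximal entropy. -/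

import Mathlib

namespace MixingChain

variable {V : Type*} [Fintype V]

/-- `π` is a stationary distribution of `P`: a probability vector with `π P = π`. -/
structure IsStationaryDist (P : Matrix V V ℝ) (π : V → ℝ) : Prop where
  nonneg : ∀ v, 0 ≤ π v
  sum_eq_one : ∑ v, π v = 1
  vecMul_eq : Matrix.vecMul π P = π

/-- A Markov chain on the finite set `V` is mixing: its transition matrix `P` is (row-)stochastic
and some power `P ^ n`, `n ≥ 1`, has only positive entries. -/
def IsMixing [DecidableEq V] (P : Matrix V V ℝ) : Prop :=
  P ∈ Matrix.rowStochastic ℝ V ∧ ∃ n : ℕ, 1 ≤ n ∧ ∀ u v, 0 < (P ^ n) u v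

/-- The absolute value of a left fixed vector of a stochastic matrix is a left fixed vector. -/
theorem vecMul_abs [DecidableEq V] {P : Matrix V V ℝ} (hP : P ∈ Matrix.rowStochastic ℝ V)
    {w : V → ℝ} (hw : Matrix.vecMul w P = w) :
    Matrix.vecMul (fun v => |w v|) P = fun v => |w v| := by
  obtain ⟨h0, h1⟩ := Matrix.mem_rowStochastic_iff_sum.1 hP
  have hle : ∀ v ∈ Finset.univ, |w v| ≤ Matrix.vecMul (fun v => |w v|) P v := by
    intro v _
    conv_lhs => rw [← hw]
    simp only [Matrix.vecMul, dotProduct]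
    refine (Finset.abs_sum_le_sum_abs _ _).trans (le_of_eq ?_)
    exact Finset.sum_congr rfl fun u _ => by rw [abs_mul, abs_of_nonneg (h0 u v)]
  have hsum : ∑ v, |w v| = ∑ v, Matrix.vecMul (fun v => |w v|) P v := by
    simp only [Matrix.vecMul, dotProduct]
    rw [Finset.sum_comm]
    simp only [← Finset.mul_sum, h1, mul_one]
  funext v
  exact ((Finset.sum_eq_sum_iff_of_le hle).1 hsum v (Finset.mem_univ v)).symm

/-- A nonnegative left fixed vector of a mixing chain is zero or has only positive entries. -/
theorem eq_zero_or_pos [DecidableEq V] {P : Matrix V V ℝ} (hP : IsMixing P)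
    {w : V → ℝ} (hw : Matrix.vecMul w P = w) (h0 : ∀ v, 0 ≤ w v) :
    w = 0 ∨ ∀ v, 0 < w v := by
  obtain ⟨_, n, _, hpos⟩ := hP
  have hn : ∀ m : ℕ, Matrix.vecMul w (P ^ m) = w := by
    intro m
    induction m with
    | zero => simp
    | succ m ih => rw [pow_succ, ← Matrix.vecMul_vecMul, ih, hw]
  by_cases hz : w = 0
  · exact Or.inl hz
  · right
    obtain ⟨u, hu⟩ := Function.ne_iff.1 hz
    intro v
    rw [← hn n]
    simp only [Matrix.vecMul, dotProduct]
    exact Finset.sum_pos' (fun x _ => mul_nonneg (h0 x) (hpos x v).le)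
      ⟨u, Finset.mem_univ u, mul_pos (lt_of_le_of_ne (h0 u) (Ne.symm hu)) (hpos u v)⟩

/-- A mixing chain on a nonempty finite set has exactly one stationary distribution. -/
theorem existsUnique_isStationaryDist [DecidableEq V] [Nonempty V] {P : Matrix V V ℝ}
    (hP : IsMixing P) : ∃! π : V → ℝ, IsStationaryDist P π := by
  have hdet : (P - 1).det = 0 := by
    refine Matrix.exists_mulVec_eq_zero_iff.1 ⟨1, one_ne_zero, ?_⟩
    rw [Matrix.sub_mulVec, Matrix.one_mulVec, (Matrix.mem_rowStochastic.1 hP.1).2, sub_self]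
  obtain ⟨w, hw0, hw⟩ := Matrix.exists_vecMul_eq_zero_iff.2 hdet
  rw [Matrix.vecMul_sub, Matrix.vecMul_one, sub_eq_zero] at hw
  have habs := vecMul_abs hP.1 hw
  obtain ⟨u, hu⟩ := Function.ne_iff.1 hw0
  have hs : 0 < ∑ v, |w v| :=
    Finset.sum_pos' (fun v _ => abs_nonneg _) ⟨u, Finset.mem_univ u, abs_pos.2 hu⟩
  refine ⟨(∑ v, |w v|)⁻¹ • fun v => |w v|, ⟨?_, ?_, ?_⟩, ?_⟩
  · intro v
    exact mul_nonneg (inv_nonneg.2 hs.le) (abs_nonneg _)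
  · simp only [Pi.smul_apply, smul_eq_mul, ← Finset.mul_sum]
    exact inv_mul_cancel₀ hs.ne'
  · rw [Matrix.smul_vecMul, habs]
  · -- uniqueness
    have key : ∀ π ρ : V → ℝ, IsStationaryDist P π → IsStationaryDist P ρ → π = ρ := by
      intro π ρ hπ hρ
      set d : V → ℝ := π - ρ with hd
      have hdP : Matrix.vecMul d P = d := by
        rw [hd, Matrix.sub_vecMul, hπ.vecMul_eq, hρ.vecMul_eq]
      have hdsum : ∑ v, d v = 0 := by
        simp only [hd, Pi.sub_apply, Finset.sum_sub_distrib, hπ.sum_eq_one, hρ.sum_eq_one,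
          sub_self]
      have hda := vecMul_abs hP.1 hdP
      have h1 : Matrix.vecMul ((fun v => |d v|) + d) P = (fun v => |d v|) + d := by
        rw [Matrix.add_vecMul, hda, hdP]
      have hz : ∀ v, d v = 0 := by
        rcases eq_zero_or_pos hP h1 (fun v => by
            have := neg_abs_le (d v); simp only [Pi.add_apply]; linarith) with h | h
        · have hneg : ∀ v, d v ≤ 0 := fun v => by
            have h2 := congrFun h v
            have h3 := abs_nonneg (d v)
            simp only [Pi.add_apply, Pi.zero_apply] at h2
            linarith
          exact fun v => (Finset.sum_eq_zero_iff_of_nonpos (fun v _ => hneg v)).1 hdsum v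
            (Finset.mem_univ v)
        · have hnn : ∀ v, 0 ≤ d v := fun v => by
            by_contra hlt
            have h2 := h v
            simp only [Pi.add_apply, abs_of_neg (not_le.1 hlt)] at h2
            linarith
          exact fun v => (Finset.sum_eq_zero_iff_of_nonneg (fun v _ => hnn v)).1 hdsum v
            (Finset.mem_univ v)
      funext v
      exact sub_eq_zero.1 (hz v)
    intro ρ hρ
    refine key ρ _ hρ ⟨?_, ?_, ?_⟩
    · intro v
      exact mul_nonneg (inv_nonneg.2 hs.le) (abs_nonneg _)
    · simp only [Pi.smul_apply, smul_eq_mul, ← Finset.mul_sum]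
      exact inv_mul_cancel₀ hs.ne'
    · rw [Matrix.smul_vecMul, habs]

/-- The stationary distribution of a mixing chain: the unique stationary distribution, by
`existsUnique_isStationaryDist`. -/
noncomputable def stationaryDist [DecidableEq V] [Nonempty V] (P : Matrix V V ℝ)
    (hP : IsMixing P) : V → ℝ :=
  (existsUnique_isStationaryDist hP).choose

/-- `stationaryDist` is a stationary distribution. -/
theorem isStationaryDist_stationaryDist [DecidableEq V] [Nonempty V] {P : Matrix V V ℝ}
    (hP : IsMixing P) : IsStationaryDist P (stationaryDist P hP) :=
  (existsUnique_isStationaryDist hP).choose_spec.1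

/-- The entropy `-∑ π(u) P(u,v) log P(u,v)` of the stationary Markov process with transition
matrix `P` and initial distribution `π` (with `0 log 0 = 0`). -/
noncomputable def entropyAt (P : Matrix V V ℝ) (π : V → ℝ) : ℝ :=
  -∑ u, ∑ v, π u * P u v * Real.log (P u v)

/-- The entropy `h(V,P)` of a mixing chain. -/
noncomputable def entropy [DecidableEq V] [Nonempty V] (P : Matrix V V ℝ) (hP : IsMixing P) : ℝ :=
  entropyAt P (stationaryDist P hP)

/-- The mixing chain `(V,P)` is a measure of maximal entropy: `h(V,P) ≥ h(V,P')` for every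
stochastic `P'` such that `P u v > 0` whenever `P' u v > 0`. Such a `P'` may have more than one
stationary distribution; the inequality is required for the entropy computed with any of them. -/
def IsMaxEntropy [DecidableEq V] [Nonempty V] (P : Matrix V V ℝ) (hP : IsMixing P) : Prop :=
  ∀ P' ∈ Matrix.rowStochastic ℝ V, (∀ u v, 0 < P' u v → 0 < P u v) →
    ∀ π' : V → ℝ, IsStationaryDist P' π' → entropyAt P' π' ≤ entropy P hP

/-- The matrix `Q` with `Q u v = P u v ^ 2`. -/
def squaredMatrix (P : Matrix V V ℝ) : Matrix V V ℝ :=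
  Matrix.of fun u v => P u v ^ 2

/-- The Perron eigenvalue of a nonnegative matrix, i.e. its spectral radius: the largest modulus
of a complex eigenvalue. -/
noncomputable def perronEigenvalue [DecidableEq V] (Q : Matrix V V ℝ) : ℝ :=
  (spectralRadius ℂ (Q.map (algebraMap ℝ ℂ))).toReal

/-- `L(V,P) = -log λ`, where `λ` is the Perron eigenvalue of `Q`, `Q u v = P u v ^ 2`. -/
noncomputable def coalescenceExponent [DecidableEq V] (P : Matrix V V ℝ) : ℝ :=
  -Real.log (perronEigenvalue (squaredMatrix P))

end MixingChain

/-!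
Let `Q(u,v) = P(u,v)²` and let `Q x = r x` with `x` and `r` positive. Such a Perron eigenvector
exists because `Q` is primitive, having the support of `P` (`exists_perron_eigenvector`), and `r` is
then the spectral radius of `Q` (`perronEigenvalue_eq`), so `L = -log r`.

If `M x = r x` for a nonnegative matrix `M`, the Doob transform `M(u,v) x(v) / (r x(u))` is a
stochastic matrix. Under a stationary distribution of another chain `P'`, the terms
`log x(v) - log x(u)` average to zero, so the cross entropy of `P'` against the Doob transform is
`log r - ∑ π'(u) P'(u,v) log M(u,v)` (`crossEntropy_doobTransform`). The Gibbs inequality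
(`entropyAt_le_crossEntropy`, equality case `eq_of_entropyAt_eq_crossEntropy`) is applied to two
matrices `M`.

* For `M = Q` and `P' = P` the cross entropy is `log r + 2 h`. Hence `h ≤ log r + 2 h`, that is
  `L ≤ h`, and equality forces `P` to be the Doob transform of `Q`, that is `P(u,v) = r x(u) / x(v)`
  wherever `P(u,v) > 0`.
* For `M` the adjacency matrix of the support of `P`, the Doob transform is the Parry chain, and the
  cross entropy is `log r` for every chain on that graph. Hence the Parry chain is the only chain
  with that support that maximizes the entropy (`isMaxEntropy_of_parry`, `IsMaxEntropy.eq_parry`).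

Both conditions say that `P(u,v) = y(v) / (s y(u))` on its support for some positive `y` and `s`,
the first with `y = 1 / x` and `s = 1 / r`. When this holds, `1 / y` is an eigenvector of `Q` with
eigenvalue `1 / s`, so `L = log s = h`.

Finally, pairing `Q x = r x` with the stationary distribution of `P` gives `r ≤ 1`, with equality
only if all entries of `P` are `0` or `1` (`squaredMatrix_eigenvalue_le_one`), and for a mixing
chain this means that there is one state (`forall_sq_eq_self_iff_card_eq_one`).
-/

namespace MixingChain

open Matrix

section Perron

variable {V : Type*} [Fintype V]

/-! ### Perron eigenvectors of primitive matrices -/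

theorem pow_apply_nonneg [DecidableEq V] {M : Matrix V V ℝ} (hM : ∀ u v, 0 ≤ M u v)
    (n : ℕ) (u v : V) : 0 ≤ (M ^ n) u v := by
  induction n generalizing v with
  | zero => by_cases h : u = v <;> simp [h]
  | succ n ih =>
    rw [pow_succ, Matrix.mul_apply]
    exact Finset.sum_nonneg fun w _ => mul_nonneg (ih w) (hM w v)

/-- Which entries of a power of a nonnegative matrix are positive depends only on which entries of
the matrix are. -/
theorem pow_apply_pos_of_support [DecidableEq V] {M N : Matrix V V ℝ} (hM : ∀ u v, 0 ≤ M u v)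
    (hN : ∀ u v, 0 ≤ N u v) (h : ∀ u v, 0 < M u v → 0 < N u v) (n : ℕ) (u v : V)
    (hpos : 0 < (M ^ n) u v) : 0 < (N ^ n) u v := by
  induction n generalizing v with
  | zero => simpa using hpos
  | succ n ih =>
    rw [pow_succ, Matrix.mul_apply] at hpos ⊢
    obtain ⟨w, hw, hlt⟩ := Finset.exists_lt_of_sum_lt (s := Finset.univ) (f := fun _ : V => (0 : ℝ))
      (g := fun w => (M ^ n) u w * M w v) (by simpa using hpos)
    have h1 : 0 < (M ^ n) u w := (pow_apply_nonneg hM n u w).lt_of_ne' (left_ne_zero_of_mul hlt.ne')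
    have h2 : 0 < M w v := (hM w v).lt_of_ne' (right_ne_zero_of_mul hlt.ne')
    exact Finset.sum_pos' (fun x _ => mul_nonneg (pow_apply_nonneg hN n u x) (hN x v))
      ⟨w, hw, mul_pos (ih w h1) (h w v h2)⟩

theorem isPrimitive_of_support [DecidableEq V] {P M : Matrix V V ℝ} (hP : IsMixing P)
    (hM : ∀ u v, 0 ≤ M u v) (h : ∀ u v, 0 < P u v → 0 < M u v) : M.IsPrimitive := by
  obtain ⟨hs, n, hn, hpos⟩ := hP
  exact ⟨hM, n, hn, fun u v => pow_apply_pos_of_support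
    (Matrix.mem_rowStochastic_iff_sum.1 hs).1 hM h n u v (hpos u v)⟩

theorem mulVec_pos {M : Matrix V V ℝ} (hM : ∀ u v, 0 < M u v) {x : V → ℝ} (hx : ∀ v, 0 ≤ x v)
    (hx0 : x ≠ 0) (u : V) : 0 < (M *ᵥ x) u := by
  obtain ⟨w, hw⟩ := Function.ne_iff.1 hx0
  exact Finset.sum_pos' (fun v _ => mul_nonneg (hM u v).le (hx v))
    ⟨w, Finset.mem_univ w, mul_pos (hM u w) ((hx w).lt_of_ne' hw)⟩

/-- Among the pairs `(x, r)` with `x` nonnegative and nonzero, `0 ≤ r` and `r x ≤ M x`, some pair has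
the largest `r`: normalizing `x` to a probability vector reduces this to a compact set of pairs. -/
theorem exists_maximal_subeigenvalue [Nonempty V] {M : Matrix V V ℝ} (hM : ∀ u v, 0 ≤ M u v) :
    ∃ (x : V → ℝ) (r : ℝ), (∀ v, 0 ≤ x v) ∧ x ≠ 0 ∧ 0 ≤ r ∧ (∀ u, r * x u ≤ (M *ᵥ x) u) ∧
      ∀ (y : V → ℝ) (s : ℝ), (∀ v, 0 ≤ y v) → y ≠ 0 → 0 ≤ s → (∀ u, s * y u ≤ (M *ᵥ y) u) →
        s ≤ r := by
  set B : ℝ := ∑ u, ∑ v, M u v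
  let S : Set ((V → ℝ) × ℝ) :=
    (stdSimplex ℝ V ×ˢ Set.Icc 0 B) ∩ ⋂ u, {p | p.2 * p.1 u ≤ (M *ᵥ p.1) u}
  have hS : IsCompact S := by
    refine ((isCompact_stdSimplex ℝ V).prod isCompact_Icc).inter_right (isClosed_iInter fun u => ?_)
    refine isClosed_le (by fun_prop) ?_
    simp only [Matrix.mulVec, dotProduct]
    fun_prop
  have hmem : ∀ (y : V → ℝ) (s : ℝ), (∀ v, 0 ≤ y v) → y ≠ 0 → 0 ≤ s →
      (∀ u, s * y u ≤ (M *ᵥ y) u) → ∃ z, (z, s) ∈ S := by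
    intro y s hy hy0 hs h
    obtain ⟨w, hw⟩ := Function.ne_iff.1 hy0
    have hc : 0 < ∑ v, y v :=
      Finset.sum_pos' (fun v _ => hy v) ⟨w, Finset.mem_univ w, (hy w).lt_of_ne' hw⟩
    set c := ∑ v, y v
    have hz0 : ∀ v, 0 ≤ (c⁻¹ • y) v := fun v => mul_nonneg (inv_nonneg.2 hc.le) (hy v)
    have hz1 : ∑ v, (c⁻¹ • y) v = 1 := by
      simp only [Pi.smul_apply, smul_eq_mul, ← Finset.mul_sum]
      exact inv_mul_cancel₀ hc.ne'
    have hz : ∀ u, s * (c⁻¹ • y) u ≤ (M *ᵥ (c⁻¹ • y)) u := by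
      intro u
      rw [Matrix.mulVec_smul]
      simp only [Pi.smul_apply, smul_eq_mul]
      rw [mul_left_comm]
      exact mul_le_mul_of_nonneg_left (h u) (inv_nonneg.2 hc.le)
    refine ⟨c⁻¹ • y, ⟨⟨⟨hz0, hz1⟩, hs, ?_⟩, Set.mem_iInter.2 hz⟩⟩
    -- summing `s z ≤ M z` over all coordinates bounds `s`, as the coordinates of `z` are at most `1`
    calc s = ∑ u, s * (c⁻¹ • y) u := by rw [← Finset.mul_sum, hz1, mul_one]
      _ ≤ ∑ u, (M *ᵥ (c⁻¹ • y)) u := Finset.sum_le_sum fun u _ => hz u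
      _ ≤ B := Finset.sum_le_sum fun u _ => Finset.sum_le_sum fun v _ =>
        mul_le_of_le_one_right (hM u v)
          (hz1 ▸ Finset.single_le_sum (fun w _ => hz0 w) (Finset.mem_univ v))
  obtain ⟨z, hz⟩ := hmem 1 0 (fun _ => zero_le_one) one_ne_zero le_rfl fun u => by
    rw [zero_mul]
    exact Finset.sum_nonneg fun v _ => mul_nonneg (hM u v) zero_le_one
  obtain ⟨⟨x, r⟩, ⟨⟨hx, hr⟩, hxr⟩, hmax⟩ := hS.exists_isMaxOn ⟨_, hz⟩ continuous_snd.continuousOn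
  refine ⟨x, r, hx.1, ?_, hr.1, Set.mem_iInter.1 hxr, ?_⟩
  · rintro rfl
    simpa using hx.2
  · intro y s hy hy0 hs h
    obtain ⟨z, hz⟩ := hmem y s hy hy0 hs h
    exact hmax hz

/-- Existence of the Perron eigenvector of a primitive matrix. -/
theorem exists_perron_eigenvector [DecidableEq V] [Nonempty V] {M : Matrix V V ℝ}
    (hM : M.IsPrimitive) :
    ∃ (x : V → ℝ) (r : ℝ), (∀ v, 0 < x v) ∧ 0 < r ∧ M *ᵥ x = r • x := by
  obtain ⟨hM0, n, hn, hpos⟩ := hM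
  obtain ⟨x, r, hx, hx0, hr, hxr, hmax⟩ := exists_maximal_subeigenvalue hM0
  have hy := mulVec_pos hpos hx hx0
  have heig : M *ᵥ x = r • x := by
    by_contra hne
    -- otherwise `y = M ^ n x` satisfies `r y < M y` in every coordinate, so `r` can be increased
    set d := M *ᵥ x - r • x with hd
    have hMd := mulVec_pos hpos (x := d) (fun v => sub_nonneg.2 (hxr v)) (sub_ne_zero.2 hne)
    have hcomm : (M ^ n) *ᵥ d = M *ᵥ ((M ^ n) *ᵥ x) - r • ((M ^ n) *ᵥ x) := by
      rw [hd, Matrix.mulVec_sub, Matrix.mulVec_smul, Matrix.mulVec_mulVec, Matrix.mulVec_mulVec,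
        (Commute.pow_self M n).eq]
    obtain ⟨w, -, hw⟩ := Finset.exists_min_image Finset.univ
      (fun u => ((M ^ n) *ᵥ d) u / ((M ^ n) *ᵥ x) u) Finset.univ_nonempty
    set ε := ((M ^ n) *ᵥ d) w / ((M ^ n) *ᵥ x) w
    have hε : 0 < ε := div_pos (hMd w) (hy w)
    have := hmax ((M ^ n) *ᵥ x) (r + ε) (fun v => (hy v).le)
      (fun h => (hy w).ne' (congrFun h w)) (by positivity) fun u => by
        have h1 := (le_div_iff₀ (hy u)).1 (hw u (Finset.mem_univ u))
        rw [hcomm] at h1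
        simp only [Pi.sub_apply, Pi.smul_apply, smul_eq_mul] at h1
        linarith
    linarith
  have hpow : ∀ m : ℕ, (M ^ m) *ᵥ x = r ^ m • x := by
    intro m
    induction m with
    | zero => simp
    | succ m ih => rw [pow_succ, ← Matrix.mulVec_mulVec, heig, Matrix.mulVec_smul, ih, smul_smul,
        pow_succ']
  have hprod : ∀ v, 0 < r ^ n * x v := fun v => by
    have := hy v
    rwa [hpow n] at this
  refine ⟨x, r, fun v => (hx v).lt_of_ne' (right_ne_zero_of_mul (hprod v).ne'), ?_, heig⟩
  refine hr.lt_of_ne' fun h => left_ne_zero_of_mul (hprod (Classical.arbitrary V)).ne' ?_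
  rw [h, zero_pow (by omega)]

/-- If a nonnegative matrix has a positive eigenvector, then the spectral radius is its
eigenvalue: for any other eigenvector `z`, compare `|z|` with the smallest multiple of the
positive eigenvector that dominates it. -/
theorem perronEigenvalue_eq [DecidableEq V] [Nonempty V] {M : Matrix V V ℝ}
    (hM : ∀ u v, 0 ≤ M u v) {x : V → ℝ} {r : ℝ} (hx : ∀ v, 0 < x v) (hr : 0 ≤ r)
    (h : M *ᵥ x = r • x) : perronEigenvalue M = r := by
  set C := M.map (algebraMap ℝ ℂ) with hC
  have hspec : ∀ k : ℂ, k ∈ spectrum ℂ C ↔ ∃ z : V → ℂ, z ≠ 0 ∧ C *ᵥ z = k • z := by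
    intro k
    rw [← Matrix.spectrum_toLin', ← Module.End.hasEigenvalue_iff_mem_spectrum]
    constructor
    · intro hk
      obtain ⟨z, hz⟩ := hk.exists_hasEigenvector
      exact ⟨z, hz.2, by simpa using hz.apply_eq_smul⟩
    · rintro ⟨z, hz0, hz⟩
      exact Module.End.hasEigenvalue_of_hasEigenvector
        ⟨Module.End.mem_eigenspace_iff.2 (by simpa using hz), hz0⟩
  have hle : ∀ k ∈ spectrum ℂ C, ‖k‖ ≤ r := by
    intro k hk
    obtain ⟨z, hz0, hz⟩ := (hspec k).1 hk
    obtain ⟨w, -, hw⟩ := Finset.exists_max_image Finset.univ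
      (fun u => ‖z u‖ / x u) Finset.univ_nonempty
    set c := ‖z w‖ / x w with hc
    have hdom : ∀ u, ‖z u‖ ≤ c * x u := fun u =>
      (div_le_iff₀ (hx u)).1 (hw u (Finset.mem_univ u))
    have hzw : ‖z w‖ = c * x w := (div_mul_cancel₀ _ (hx w).ne').symm
    have hc0 : 0 < c := by
      obtain ⟨u, hu⟩ := Function.ne_iff.1 hz0
      have h1 : 0 < ‖z u‖ := norm_pos_iff.2 hu
      exact pos_of_mul_pos_left (h1.trans_le (hdom u)) (hx u).le
    have key : ‖k‖ * (c * x w) ≤ r * (c * x w) := by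
      calc ‖k‖ * (c * x w) = ‖(C *ᵥ z) w‖ := by
            rw [hz, Pi.smul_apply, smul_eq_mul, norm_mul, hzw]
        _ ≤ ∑ v, ‖C w v * z v‖ := norm_sum_le _ _
        _ ≤ ∑ v, M w v * (c * x v) := by
            refine Finset.sum_le_sum fun v _ => ?_
            rw [norm_mul, hC, Matrix.map_apply, norm_algebraMap', Real.norm_of_nonneg (hM w v)]
            exact mul_le_mul_of_nonneg_left (hdom v) (hM w v)
        _ = c * (M *ᵥ x) w := by
            simp only [Matrix.mulVec, dotProduct, Finset.mul_sum]
            exact Finset.sum_congr rfl fun v _ => by ring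
        _ = r * (c * x w) := by
            rw [h, Pi.smul_apply, smul_eq_mul]; ring
    exact le_of_mul_le_mul_right key (mul_pos hc0 (hx w))
  have hmem : (r : ℂ) ∈ spectrum ℂ C := by
    refine (hspec _).2 ⟨fun v => (x v : ℂ), fun h0 => ?_, ?_⟩
    · have := congrFun h0 (Classical.arbitrary V)
      exact (hx _).ne' (by simpa using this)
    · funext u
      have := congrArg (algebraMap ℝ ℂ) (congrFun h u)
      simpa [hC, Matrix.mulVec, dotProduct] using this
  have hrad : spectralRadius ℂ C = ENNReal.ofReal r := by
    refine le_antisymm (iSup₂_le fun k hk => ?_) ?_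
    · rw [← enorm_eq_nnnorm, ← ofReal_norm]
      exact ENNReal.ofReal_le_ofReal (hle k hk)
    · refine le_trans (le_of_eq ?_) (le_iSup₂ (f := fun k _ => (‖k‖₊ : ENNReal)) (r : ℂ) hmem)
      rw [← enorm_eq_nnnorm, ← ofReal_norm, Complex.norm_real, Real.norm_of_nonneg hr]
  rw [perronEigenvalue, ← hC, hrad, ENNReal.toReal_ofReal hr]

end Perron

section Entrywise

/-! ### Doob transforms, support matrices and squared matrices -/

variable {V : Type*} {P M : Matrix V V ℝ} {x : V → ℝ} {r : ℝ}

/-- The Doob transform of `M` by the vector `x` and the number `r`: the matrix with entries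
`M(u,v) x(v) / (r x(u))`. It is stochastic if `M` is nonnegative, `x` and `r` are positive and
`M x = r x`. -/
noncomputable def doobTransform (M : Matrix V V ℝ) (x : V → ℝ) (r : ℝ) : Matrix V V ℝ :=
  Matrix.of fun u v => M u v * x v / (r * x u)

theorem doobTransform_pos (hx : ∀ v, 0 < x v) (hr : 0 < r) {u v : V} (h : 0 < M u v) :
    0 < doobTransform M x r u v :=
  div_pos (mul_pos h (hx v)) (mul_pos hr (hx u))

theorem pos_of_doobTransform_pos (hx : ∀ v, 0 < x v) (hr : 0 < r) {u v : V}
    (h : 0 < doobTransform M x r u v) : 0 < M u v :=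
  pos_of_mul_pos_left ((div_pos_iff_of_pos_right (mul_pos hr (hx u))).1 h) (hx v).le

open Classical in
/-- The `0`-`1` adjacency matrix of the graph of allowed transitions of `P`. Its Doob transform by
the Perron eigenvector is the transition matrix of the Parry chain. -/
noncomputable def supportMatrix (P : Matrix V V ℝ) : Matrix V V ℝ :=
  Matrix.of fun u v => if 0 < P u v then 1 else 0

theorem supportMatrix_pos_iff {u v : V} : 0 < supportMatrix P u v ↔ 0 < P u v := by
  by_cases h : 0 < P u v <;> simp [supportMatrix, h]

theorem supportMatrix_nonneg (P : Matrix V V ℝ) (u v : V) : 0 ≤ supportMatrix P u v := by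
  by_cases h : 0 < P u v <;> simp [supportMatrix, h]

theorem squaredMatrix_nonneg (P : Matrix V V ℝ) (u v : V) : 0 ≤ squaredMatrix P u v :=
  sq_nonneg _

end Entrywise

variable {V : Type*} [Fintype V]

/-! ### The Gibbs inequality -/

/-- One term of the Gibbs inequality. When `p = 0` the left side is `0`, whatever `log q` is. -/
theorem mul_log_sub_mul_log_le {p q : ℝ} (hp : 0 ≤ p) (hq : 0 ≤ q) (h : 0 < p → 0 < q) :
    p * Real.log q - p * Real.log p ≤ q - p := by
  rcases hp.eq_or_lt with rfl | hp
  · simpa using hq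
  · have h1 := Real.log_le_sub_one_of_pos (div_pos (h hp) hp)
    rw [Real.log_div (h hp).ne' hp.ne'] at h1
    calc p * Real.log q - p * Real.log p = p * (Real.log q - Real.log p) := by ring
      _ ≤ p * (q / p - 1) := mul_le_mul_of_nonneg_left h1 hp.le
      _ = q - p := by field_simp

theorem eq_of_mul_log_sub_mul_log_eq {p q : ℝ} (hp : 0 ≤ p) (h : 0 < p → 0 < q)
    (heq : p * Real.log q - p * Real.log p = q - p) : p = q := by
  rcases hp.eq_or_lt with rfl | hp
  · simpa using heq
  · by_contra hne
    have h1 := Real.log_lt_sub_one_of_pos (div_pos (h hp) hp)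
      (fun h2 => hne ((div_eq_one_iff_eq hp.ne').1 h2).symm)
    rw [Real.log_div (h hp).ne' hp.ne'] at h1
    refine heq.not_lt ?_
    calc p * Real.log q - p * Real.log p = p * (Real.log q - Real.log p) := by ring
      _ < p * (q / p - 1) := mul_lt_mul_of_pos_left h1 hp
      _ = q - p := by field_simp

/-- The cross entropy `-∑ π(u) P(u,v) log M(u,v)`. As `log 0 = 0`, a pair with `M(u,v) = 0`
contributes nothing, so this is the usual notion only if `M(u,v) > 0` wherever `P(u,v) > 0`. -/
noncomputable def crossEntropy (P M : Matrix V V ℝ) (π : V → ℝ) : ℝ :=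
  -∑ u, ∑ v, π u * P u v * Real.log (M u v)

variable {P R : Matrix V V ℝ} {π : V → ℝ}

theorem entropyAt_sub_crossEntropy (P R : Matrix V V ℝ) (π : V → ℝ) :
    entropyAt P π - crossEntropy P R π =
      ∑ u, ∑ v, π u * (P u v * Real.log (R u v) - P u v * Real.log (P u v)) := by
  simp only [entropyAt, crossEntropy, mul_sub, Finset.sum_sub_distrib, mul_assoc]
  ring

theorem sum_mul_sub_eq_zero [DecidableEq V] (hP : P ∈ rowStochastic ℝ V)
    (hR : R ∈ rowStochastic ℝ V) (π : V → ℝ) : ∑ u, ∑ v, π u * (R u v - P u v) = 0 := by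
  simp only [← Finset.mul_sum, Finset.sum_sub_distrib, sum_row_of_mem_rowStochastic hP,
    sum_row_of_mem_rowStochastic hR, sub_self, mul_zero, Finset.sum_const_zero]

/-- The Gibbs inequality for Markov chains. -/
theorem entropyAt_le_crossEntropy [DecidableEq V] (hP : P ∈ rowStochastic ℝ V)
    (hR : R ∈ rowStochastic ℝ V) (h : ∀ u v, 0 < P u v → 0 < R u v) (hπ : ∀ v, 0 ≤ π v) :
    entropyAt P π ≤ crossEntropy P R π := by
  rw [← sub_nonpos, entropyAt_sub_crossEntropy, ← sum_mul_sub_eq_zero hP hR π]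
  exact Finset.sum_le_sum fun u _ => Finset.sum_le_sum fun v _ => mul_le_mul_of_nonneg_left
    (mul_log_sub_mul_log_le (hP.1 u v) (hR.1 u v) (h u v)) (hπ u)

/-- The equality case of the Gibbs inequality. -/
theorem eq_of_entropyAt_eq_crossEntropy [DecidableEq V] (hP : P ∈ rowStochastic ℝ V)
    (hR : R ∈ rowStochastic ℝ V) (h : ∀ u v, 0 < P u v → 0 < R u v) (hπ : ∀ v, 0 < π v)
    (heq : entropyAt P π = crossEntropy P R π) : P = R := by
  have hle : ∀ u v, π u * (P u v * Real.log (R u v) - P u v * Real.log (P u v)) ≤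
      π u * (R u v - P u v) := fun u v => mul_le_mul_of_nonneg_left
    (mul_log_sub_mul_log_le (hP.1 u v) (hR.1 u v) (h u v)) (hπ u).le
  have h0 := entropyAt_sub_crossEntropy P R π
  rw [heq, sub_self, ← sum_mul_sub_eq_zero hP hR π] at h0
  ext u v
  have h1 := (Finset.sum_eq_sum_iff_of_le fun u _ => Finset.sum_le_sum fun v _ => hle u v).1
    h0.symm u (Finset.mem_univ u)
  have h2 := (Finset.sum_eq_sum_iff_of_le fun v _ => hle u v).1 h1 v (Finset.mem_univ v)
  exact eq_of_mul_log_sub_mul_log_eq (hP.1 u v) (h u v) (mul_left_cancel₀ (hπ u).ne' h2)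

/-! ### Cross entropy against a Doob transform -/

variable {M : Matrix V V ℝ} {x : V → ℝ} {r : ℝ}

theorem doobTransform_mem_rowStochastic [DecidableEq V] (hM : ∀ u v, 0 ≤ M u v)
    (hx : ∀ v, 0 < x v) (hr : 0 < r) (h : M *ᵥ x = r • x) :
    doobTransform M x r ∈ rowStochastic ℝ V := by
  refine mem_rowStochastic_iff_sum.2 ⟨fun u v => ?_, fun u => ?_⟩
  · exact div_nonneg (mul_nonneg (hM u v) (hx v).le) (mul_pos hr (hx u)).le
  · have h1 : ∑ v, M u v * x v = r * x u := congrFun h u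
    simp only [doobTransform, of_apply, ← Finset.sum_div, h1]
    exact div_self (mul_pos hr (hx u)).ne'

/-- Under a stationary distribution the coboundary `log x(v) - log x(u)` has mean zero. -/
theorem sum_mul_coboundary_eq_zero [DecidableEq V] (hP : P ∈ rowStochastic ℝ V)
    (hπ : IsStationaryDist P π) (f : V → ℝ) : ∑ u, ∑ v, π u * P u v * (f v - f u) = 0 := by
  simp only [mul_sub, Finset.sum_sub_distrib]
  rw [Finset.sum_comm, sub_eq_zero]
  trans ∑ v, π v * f v
  · refine Finset.sum_congr rfl fun v _ => ?_
    rw [← Finset.sum_mul]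
    exact congrArg (· * f v) (congrFun hπ.vecMul_eq v)
  · refine Finset.sum_congr rfl fun u _ => ?_
    rw [← Finset.sum_mul, ← Finset.mul_sum, sum_row_of_mem_rowStochastic hP, mul_one]

/-- The cross entropy against a Doob transform of `M` is that against `M`, up to `log r`. -/
theorem crossEntropy_doobTransform [DecidableEq V] (hP : P ∈ rowStochastic ℝ V)
    (hπ : IsStationaryDist P π) (hx : ∀ v, 0 < x v) (hr : 0 < r)
    (h : ∀ u v, 0 < P u v → 0 < M u v) :
    crossEntropy P (doobTransform M x r) π = Real.log r + crossEntropy P M π := by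
  have h1 : ∀ u v, π u * P u v * Real.log (doobTransform M x r u v) =
      π u * P u v * Real.log (M u v) + π u * P u v * (Real.log (x v) - Real.log (x u)) -
        π u * P u v * Real.log r := by
    intro u v
    rcases (hP.1 u v).eq_or_lt with h0 | h0
    · simp [← h0]
    · rw [doobTransform, of_apply, Real.log_div (mul_pos (h u v h0) (hx v)).ne'
        (mul_pos hr (hx u)).ne', Real.log_mul (h u v h0).ne' (hx v).ne',
        Real.log_mul hr.ne' (hx u).ne']
      ring
  have h2 : ∑ u, ∑ v, π u * P u v * Real.log r = Real.log r := by
    simp only [← Finset.sum_mul, ← Finset.mul_sum, sum_row_of_mem_rowStochastic hP, mul_one,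
      hπ.sum_eq_one, one_mul]
  simp only [crossEntropy, h1, Finset.sum_sub_distrib, Finset.sum_add_distrib, h2,
    sum_mul_coboundary_eq_zero hP hπ fun v => Real.log (x v)]
  ring

/-! ### The Parry chain of the support graph -/

theorem crossEntropy_supportMatrix (P P' : Matrix V V ℝ) (π : V → ℝ) :
    crossEntropy P' (supportMatrix P) π = 0 := by
  have h : ∀ u v, Real.log (supportMatrix P u v) = 0 := fun u v => by
    by_cases h : 0 < P u v <;> simp [supportMatrix, h]
  simp [crossEntropy, h]

/-- Every chain carried by the support graph has cross entropy `log r` against the Parry chain. -/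
theorem crossEntropy_parry [DecidableEq V] {P' : Matrix V V ℝ} (hP' : P' ∈ rowStochastic ℝ V)
    (hπ : IsStationaryDist P' π) (hx : ∀ v, 0 < x v) (hr : 0 < r)
    (h : ∀ u v, 0 < P' u v → 0 < P u v) :
    crossEntropy P' (doobTransform (supportMatrix P) x r) π = Real.log r := by
  rw [crossEntropy_doobTransform hP' hπ hx hr fun u v huv => supportMatrix_pos_iff.2 (h u v huv),
    crossEntropy_supportMatrix, add_zero]

/-! ### The squared matrix -/

theorem squaredMatrix_pos_iff [DecidableEq V] (hP : P ∈ rowStochastic ℝ V) {u v : V} :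
    0 < squaredMatrix P u v ↔ 0 < P u v :=
  ⟨fun h => (hP.1 u v).lt_of_ne' fun h0 => by simp [squaredMatrix, h0] at h, fun h => pow_pos h 2⟩

theorem crossEntropy_squaredMatrix (P : Matrix V V ℝ) (π : V → ℝ) :
    crossEntropy P (squaredMatrix P) π = 2 * entropyAt P π := by
  simp only [crossEntropy, entropyAt, squaredMatrix, of_apply, Real.log_pow, Nat.cast_ofNat,
    mul_left_comm _ (2 : ℝ), ← Finset.mul_sum]
  ring

/-- If `P(u,v) = P(u,v)² x(v) / (r x(u))`, then `P(u,v) = r x(u) / x(v)` on the support. -/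
theorem eq_parry_of_eq_doobTransform_squaredMatrix [DecidableEq V]
    (hP : P ∈ rowStochastic ℝ V) (hx : ∀ v, 0 < x v) (hr : 0 < r)
    (h : P = doobTransform (squaredMatrix P) x r) :
    P = doobTransform (supportMatrix P) (fun v => (x v)⁻¹) r⁻¹ := by
  ext u v
  rcases (hP.1 u v).eq_or_lt with h0 | h0
  · simp [doobTransform, supportMatrix, ← h0]
  · have h1 : P u v = P u v ^ 2 * x v / (r * x u) := congrFun (congrFun h u) v
    have := (hx v).ne'
    have := (hx u).ne'
    simp only [doobTransform, supportMatrix, of_apply, h0, if_true]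
    field_simp at h1 ⊢
    linarith

variable [DecidableEq V] [Nonempty V]

theorem stationaryDist_pos (hP : IsMixing P) (v : V) : 0 < stationaryDist P hP v := by
  have h := isStationaryDist_stationaryDist hP
  refine (eq_zero_or_pos hP h.vecMul_eq h.nonneg).resolve_left (fun h0 => ?_) v
  simpa [h0] using h.sum_eq_one

/-- A Perron eigenvector of the squared matrix of a mixing chain, with the eigenvalue identified
as the one that defines the coalescence exponent. -/
theorem exists_squaredMatrix_eigenvector (hP : IsMixing P) :
    ∃ (x : V → ℝ) (r : ℝ), (∀ v, 0 < x v) ∧ 0 < r ∧ squaredMatrix P *ᵥ x = r • x ∧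
      coalescenceExponent P = -Real.log r := by
  obtain ⟨x, r, hx, hr, h⟩ := exists_perron_eigenvector
    (isPrimitive_of_support hP (squaredMatrix_nonneg P) fun u v => (squaredMatrix_pos_iff hP.1).2)
  exact ⟨x, r, hx, hr, h, by
    rw [coalescenceExponent, perronEigenvalue_eq (squaredMatrix_nonneg P) hx hr.le h]⟩

/-! ### The bound `r ≤ 1` and chains with one state -/

/-- Pairing `Q x = r x` with `π` gives `r π·x = ∑ π(u) P(u,v)² x(v) ≤ ∑ π(u) P(u,v) x(v) = π·x`,
with equality only if `P(u,v)² = P(u,v)` for all `u` and `v`. -/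
theorem squaredMatrix_eigenvalue_le_one (hP : IsMixing P) (hx : ∀ v, 0 < x v)
    (h : squaredMatrix P *ᵥ x = r • x) : r ≤ 1 ∧ (r = 1 ↔ ∀ u v, P u v ^ 2 = P u v) := by
  set ρ := stationaryDist P hP
  have hρ : IsStationaryDist P ρ := isStationaryDist_stationaryDist hP
  have hpos : 0 < ρ ⬝ᵥ x :=
    Finset.sum_pos (fun v _ => mul_pos (stationaryDist_pos hP v) (hx v)) Finset.univ_nonempty
  have h1 : r * (ρ ⬝ᵥ x) = ∑ u, ∑ v, ρ u * (P u v ^ 2 * x v) := by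
    rw [← smul_eq_mul, ← dotProduct_smul, ← h]
    simp only [dotProduct, mulVec, squaredMatrix, of_apply, Finset.mul_sum]
  have h2 : ρ ⬝ᵥ x = ∑ u, ∑ v, ρ u * (P u v * x v) := by
    conv_lhs => rw [← hρ.vecMul_eq, ← dotProduct_mulVec]
    simp only [dotProduct, mulVec, Finset.mul_sum]
  have hle : ∀ u v, ρ u * (P u v ^ 2 * x v) ≤ ρ u * (P u v * x v) := fun u v =>
    mul_le_mul_of_nonneg_left (mul_le_mul_of_nonneg_right
      (pow_le_of_le_one (hP.1.1 u v) (le_one_of_mem_rowStochastic hP.1) two_ne_zero) (hx v).le)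
      (hρ.nonneg u)
  have hiff : r = 1 ↔ r * (ρ ⬝ᵥ x) = ρ ⬝ᵥ x := by rw [mul_eq_right₀ hpos.ne']
  refine ⟨?_, hiff.trans ⟨fun heq u v => ?_, fun heq => ?_⟩⟩
  · refine le_of_mul_le_mul_right ?_ hpos
    rw [one_mul, h1, h2]
    exact Finset.sum_le_sum fun u _ => Finset.sum_le_sum fun v _ => hle u v
  · rw [h1, h2] at heq
    have h3 := (Finset.sum_eq_sum_iff_of_le fun u _ => Finset.sum_le_sum fun v _ => hle u v).1
      heq u (Finset.mem_univ u)
    have h4 := (Finset.sum_eq_sum_iff_of_le fun v _ => hle u v).1 h3 v (Finset.mem_univ v)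
    exact mul_right_cancel₀ (hx v).ne' (mul_left_cancel₀ (stationaryDist_pos hP u).ne' h4)
  · rw [h1, h2]
    simp only [heq]

/-- A mixing chain with all transition probabilities `0` or `1` has a single state: a power with
positive entries is then an integer matrix with entries at least `1` and row sums `1`. -/
theorem forall_sq_eq_self_iff_card_eq_one (hP : IsMixing P) :
    (∀ u v, P u v ^ 2 = P u v) ↔ Fintype.card V = 1 := by
  constructor
  · intro h
    obtain ⟨hs, n, -, hpos⟩ := hP
    have hnat : ∀ u v, ∃ k : ℕ, P u v = k := fun u v => by
      have h1 : P u v * (P u v - 1) = 0 := by linear_combination h u v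
      rcases mul_eq_zero.1 h1 with h0 | h0
      exacts [⟨0, by simpa using h0⟩, ⟨1, by simpa using sub_eq_zero.1 h0⟩]
    choose N hN using hnat
    have hPN : P ^ n = ((Matrix.of N) ^ n).map (Nat.castRingHom ℝ) := by
      rw [Matrix.map_pow]
      congr 1
      ext u v
      simp [hN]
    have hone : ∀ u v, 1 ≤ (P ^ n) u v := fun u v => by
      have h1 := hpos u v
      rw [hPN] at h1 ⊢
      simp only [map_apply, Nat.coe_castRingHom, Nat.cast_pos, Nat.one_le_cast] at h1 ⊢
      exact h1
    obtain ⟨u⟩ := ‹Nonempty V›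
    have hsum := sum_row_of_mem_rowStochastic (pow_mem hs n) u
    have hcard : (Fintype.card V : ℝ) ≤ 1 := by
      calc (Fintype.card V : ℝ) = ∑ _v : V, (1 : ℝ) := by simp
        _ ≤ ∑ v, (P ^ n) u v := Finset.sum_le_sum fun v _ => hone u v
        _ = 1 := hsum
    exact le_antisymm (by exact_mod_cast hcard) (Fintype.card_pos_iff.2 ⟨u⟩)
  · intro h u v
    have := Fintype.card_le_one_iff_subsingleton.1 h.le
    have h1 := sum_row_of_mem_rowStochastic hP.1 u
    rw [Fintype.sum_subsingleton _ v] at h1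
    rw [h1, one_pow]

/-! ### Maximal entropy and the equality case -/

/-- If `P` is the Parry chain of its support graph, then `P(u,v) = y(v) / (r y(u))` wherever it is
positive, so `P(u,v)² / y(v) = P(u,v) / (r y(u))`, and summing over `v` shows that `1 / y` is an
eigenvector of the squared matrix with eigenvalue `1 / r`. -/
theorem coalescenceExponent_eq_of_parry {y : V → ℝ} (hP : P ∈ rowStochastic ℝ V)
    (hy : ∀ v, 0 < y v) (hr : 0 < r) (h : P = doobTransform (supportMatrix P) y r) :
    coalescenceExponent P = Real.log r := by
  have hsq : ∀ u v, P u v ^ 2 * (y v)⁻¹ = P u v * (r⁻¹ * (y u)⁻¹) := by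
    intro u v
    rcases (hP.1 u v).eq_or_lt with h0 | h0
    · simp [← h0]
    · have h1 : P u v = y v / (r * y u) := by
        conv_lhs => rw [h]
        simp [doobTransform, supportMatrix, h0]
      have := (hy v).ne'
      have := (hy u).ne'
      rw [sq, mul_assoc]
      congr 1
      rw [h1]
      field_simp
  have heig : squaredMatrix P *ᵥ (fun v => (y v)⁻¹) = r⁻¹ • fun v => (y v)⁻¹ := by
    funext u
    simp only [mulVec, dotProduct, squaredMatrix, of_apply, hsq, ← Finset.sum_mul,
      sum_row_of_mem_rowStochastic hP, one_mul, Pi.smul_apply, smul_eq_mul]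
  rw [coalescenceExponent, perronEigenvalue_eq (squaredMatrix_nonneg P)
    (fun v => inv_pos.2 (hy v)) (inv_pos.2 hr).le heig, Real.log_inv, neg_neg]

/-- The Parry chain of the support graph of `P` maximizes the entropy. -/
theorem isMaxEntropy_of_parry {y : V → ℝ} (hP : IsMixing P) (hy : ∀ v, 0 < y v) (hr : 0 < r)
    (h : P = doobTransform (supportMatrix P) y r) :
    IsMaxEntropy P hP ∧ entropy P hP = Real.log r := by
  have hent : entropy P hP = Real.log r := by
    have h1 := crossEntropy_parry hP.1 (isStationaryDist_stationaryDist hP) hy hr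
      fun _ _ huv => huv
    rw [← h] at h1
    exact h1
  refine ⟨fun P' hP' hsupp ρ hρ => ?_, hent⟩
  rw [hent, ← crossEntropy_parry hP' hρ hy hr hsupp, ← h]
  exact entropyAt_le_crossEntropy hP' hP.1 hsupp hρ.nonneg

/-- A measure of maximal entropy is the Parry chain of its support graph. -/
theorem IsMaxEntropy.eq_parry {hP : IsMixing P} (hmax : IsMaxEntropy P hP) :
    ∃ (y : V → ℝ) (r : ℝ), (∀ v, 0 < y v) ∧ 0 < r ∧
      P = doobTransform (supportMatrix P) y r := by
  have hprim := isPrimitive_of_support hP (supportMatrix_nonneg P)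
    fun u v => supportMatrix_pos_iff.2
  obtain ⟨y, r, hy, hr, h⟩ := exists_perron_eigenvector hprim
  refine ⟨y, r, hy, hr, ?_⟩
  set R := doobTransform (supportMatrix P) y r
  have hR : R ∈ rowStochastic ℝ V :=
    doobTransform_mem_rowStochastic (supportMatrix_nonneg P) hy hr h
  have hPR : ∀ u v, 0 < P u v → 0 < R u v := fun u v huv =>
    doobTransform_pos hy hr (supportMatrix_pos_iff.2 huv)
  have hRP : ∀ u v, 0 < R u v → 0 < P u v := fun u v huv =>
    supportMatrix_pos_iff.1 (pos_of_doobTransform_pos hy hr huv)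
  have hRmix : IsMixing R := ⟨hR, (isPrimitive_of_support hP hR.1 hPR).exists_pos_pow⟩
  have hρ := isStationaryDist_stationaryDist hRmix
  have hπ := isStationaryDist_stationaryDist hP
  refine eq_of_entropyAt_eq_crossEntropy hP.1 hR hPR (stationaryDist_pos hP)
    (le_antisymm (entropyAt_le_crossEntropy hP.1 hR hPR hπ.nonneg) ?_)
  rw [crossEntropy_parry hP.1 hπ hy hr fun _ _ huv => huv,
    ← crossEntropy_parry hR hρ hy hr hRP]
  exact hmax R hR hRP _ hρ

/-- The Gibbs inequality for `P` against the Doob transform of its squared matrix, whose cross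
entropy is `log r + 2 h`. -/
theorem coalescenceExponent_le_entropy (hP : IsMixing P) :
    coalescenceExponent P ≤ entropy P hP ∧ (coalescenceExponent P = entropy P hP →
      ∃ (x : V → ℝ) (r : ℝ), (∀ v, 0 < x v) ∧ 0 < r ∧ P = doobTransform (squaredMatrix P) x r) := by
  obtain ⟨x, r, hx, hr, h, hL⟩ := exists_squaredMatrix_eigenvector hP
  have hπ := isStationaryDist_stationaryDist hP
  have hsupp : ∀ u v, 0 < P u v → 0 < squaredMatrix P u v := fun u v =>
    (squaredMatrix_pos_iff hP.1).2
  have hpos : ∀ u v, 0 < P u v → 0 < doobTransform (squaredMatrix P) x r u v := fun u v huv =>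
    doobTransform_pos hx hr (hsupp u v huv)
  have hD := doobTransform_mem_rowStochastic (squaredMatrix_nonneg P) hx hr h
  have hcross := crossEntropy_doobTransform hP.1 hπ hx hr hsupp
  rw [crossEntropy_squaredMatrix] at hcross
  refine ⟨?_, fun heq => ⟨x, r, hx, hr, ?_⟩⟩
  · have := entropyAt_le_crossEntropy hP.1 hD hpos hπ.nonneg
    rw [hL, entropy]
    linarith
  · refine eq_of_entropyAt_eq_crossEntropy hP.1 hD hpos (stationaryDist_pos hP) ?_
    rw [hL, entropy] at heq
    linarith

end MixingChain

theorem theorem2 {V : Type*} [Fintype V] [DecidableEq V] [Nonempty V] (P : Matrix V V ℝ)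
    (hP : MixingChain.IsMixing P) :
    (0 ≤ MixingChain.coalescenceExponent P ∧
      MixingChain.coalescenceExponent P ≤ MixingChain.entropy P hP) ∧
    (MixingChain.coalescenceExponent P = 0 ↔ Fintype.card V = 1) ∧
    (MixingChain.coalescenceExponent P = MixingChain.entropy P hP ↔
      MixingChain.IsMaxEntropy P hP) := by
  obtain ⟨x, r, hx, hr, h, hL⟩ := MixingChain.exists_squaredMatrix_eigenvector hP
  obtain ⟨hr1, hr_iff⟩ := MixingChain.squaredMatrix_eigenvalue_le_one hP hx h
  obtain ⟨hle, heq⟩ := MixingChain.coalescenceExponent_le_entropy hP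
  refine ⟨⟨?_, hle⟩, ?_, fun hLh => ?_, fun hmax => ?_⟩
  · rw [hL, neg_nonneg]
    exact Real.log_nonpos hr.le hr1
  · rw [← MixingChain.forall_sq_eq_self_iff_card_eq_one hP, ← hr_iff, hL, neg_eq_zero]
    refine ⟨Real.eq_one_of_pos_of_log_eq_zero hr, fun h1 => by rw [h1, Real.log_one]⟩
  · obtain ⟨y, s, hy, hs, hPs⟩ := heq hLh
    exact (MixingChain.isMaxEntropy_of_parry hP (fun v => inv_pos.2 (hy v)) (inv_pos.2 hs)
      (MixingChain.eq_parry_of_eq_doobTransform_squaredMatrix hP.1 hy hs hPs)).1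
  · obtain ⟨y, s, hy, hs, hPs⟩ := hmax.eq_parry
    rw [MixingChain.coalescenceExponent_eq_of_parry hP.1 hy hs hPs,
      (MixingChain.isMaxEntropy_of_parry hP hy hs hPs).2]
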